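/- Let $\langle \mathbb{V}(X),\mathbb{V}(X),\ast\rangle$ be a single superstructure model of nonstandard methods: $X$ is an infinite set of atoms, $\mathbb{V}(X)=\bigcup_{k\in\mathbb{N}}V_k$ with $V_0=X$ and $V_{k+1}=V_k\cup\mathcal{P}(V_k)$ is the superstructure on $X$, and $\ast:\mathbb{V}(X)\to\mathbb{V}(X)$ is a map satisfying the transfer principle (for every bounded-quantifier formula $\varphi(x_1,\dots,x_k)$ of the language of set theory and all $a_1,\dots,a_k\in\mathbb{V}(X)$, $\varphi(a_1,\dots,a_k)$ holds in $\mathbb{V}(X)$ if and only if $\varphi({}^{\ast}a_1,\dots,{}^{\ast}a_k)$ does). Put $S_0=\mathrm{id}$ and $S_{k+1}=\ast\circ S_k$. For an ultrafilter $\mathcal{W}$ on a set $Y\in\mathbb{V}(X)$ and $k\in\mathbb{N}=\{0,1,2,\dots\}$, let $$\mu_k(\mathcal{W})=\bigcap_{A\in\mathcal{W}}S_k(A),\qquad \mu_\infty(\mathcal{W})=\bigcap_{A\in\mathcal{W}}\ \bigcup_{k\in\mathbb{N}}S_k(A);$$ the elements of $\mu_\infty(\mathcal{W})$ are called the generators of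 $\mathcal{W}$. A set $Y\in\mathbb{V}(X)$ is called completely coherent if $A\subseteq{}^{\ast}A$ for every $A\subseteq Y$. For ultrafilters $\mathcal{U}$ on $Y$ and $\mathcal{V}$ on $Z$, $\mathcal{U}\otimes\mathcal{V}$ is the ultrafilter on $Y\times Z$ such that, for all $A\subseteq Y\times Z$, $A\in\mathcal{U}\otimes\mathcal{V}$ if and only if $\{y\in Y:\{z\in Z:(y,z)\in A\}\in\mathcal{V}\}\in\mathcal{U}$. **Theorem.** Let $n,m\in\mathbb{N}$, let $Y,Z\in\mathbb{V}(X)$ be sets with $Y$ completely coherent, let $\mathcal{U}$ be an ultrafilter on $Y$ and $\mathcal{V}$ an ultrafilter on $Z$, and let $\alpha\in\mu_n(\mathcal{U})$ and $\beta\in\mu_m(\mathcal{V})$. Then $(\alpha,S_n(\beta))\in\mu_{n+m}(\mathcal{U}\otimes\mathcal{V})$. In particular, $(\alpha,S_n(\beta))$ is a generator of $\mathcal{U}\otimes\mathcal{V}$. -/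

import Mathlib

universe u

namespace IteratedHyper

/-! ### Superstructures -/

/-- The levels `V_0(X) = X`, `V_{n+1}(X) = V_n(X) ∪ 𝒫(V_n(X))` of the superstructure on `X`. -/
noncomputable def level (X : ZFSet.{u}) : ℕ → ZFSet.{u}
  | 0 => X
  | n + 1 => level X n ∪ (level X n).powerset

/-- The superstructure `V(X) = ⋃ n, V_n(X)`. -/
def superstructure (X : ZFSet.{u}) : Set ZFSet.{u} := {x | ∃ n, x ∈ level X n}

/-- The superstructure on `X`, as a type. -/
abbrev VX (X : ZFSet.{u}) : Type (u + 1) := {x : ZFSet.{u} // x ∈ superstructure X}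

/-- `X` is a base set: its elements behave as atoms (individuals) in the superstructure, that is,
they are not the empty set and none of their members lies in `V(X)`. -/
def IsBaseSet (X : ZFSet.{u}) : Prop :=
  ∅ ∉ X ∧ ∀ x ∈ X, ∀ y ∈ x, y ∉ superstructure X

theorem level_mono {X : ZFSet.{u}} {m n : ℕ} (h : m ≤ n) {x : ZFSet.{u}} (hx : x ∈ level X m) :
    x ∈ level X n := by
  induction h with
  | refl => exact hx
  | step _ ih => exact ZFSet.mem_union.2 (Or.inl ih)

theorem mem_level_succ_of_subset {X x : ZFSet.{u}} {n : ℕ} (h : x ⊆ level X n) :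
    x ∈ level X (n + 1) :=
  ZFSet.mem_union.2 (Or.inr (ZFSet.mem_powerset.2 h))

theorem pair_mem_level {X x y : ZFSet.{u}} {n : ℕ} (hx : x ∈ level X n) (hy : y ∈ level X n) :
    ZFSet.pair x y ∈ level X (n + 2) := by
  refine mem_level_succ_of_subset fun z hz => ?_
  refine mem_level_succ_of_subset fun w hw => ?_
  simp only [ZFSet.pair, ZFSet.mem_pair] at hz
  rcases hz with rfl | rfl
  · rw [ZFSet.mem_singleton] at hw
    exact hw ▸ hx
  · rcases ZFSet.mem_pair.1 hw with rfl | rfl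
    · exact hx
    · exact hy

/-- The (Kuratowski) ordered pair of two elements of `V(X)`, which is again an element of `V(X)`. -/
noncomputable def VX.pair {X : ZFSet.{u}} (x y : VX X) : VX X :=
  ⟨ZFSet.pair x.1 y.1, by
    obtain ⟨m, hx⟩ := x.2
    obtain ⟨n, hy⟩ := y.2
    exact ⟨_, pair_mem_level (level_mono (le_max_left m n) hx) (level_mono (le_max_right m n) hy)⟩⟩

/-- The sets in `V(X)`, as opposed to the atoms: the subsets of the levels of `V(X)`.
See `isSet_iff`: if `X` is a base set, these are the elements of `V(X)` that are not in `X`. -/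
def VSet (X : ZFSet.{u}) : Type (u + 1) := {Y : ZFSet.{u} // ∃ n, Y ⊆ level X n}

theorem isSet_iff {X : ZFSet.{u}} (hX : IsBaseSet X) (Y : ZFSet.{u}) :
    (∃ n, Y ⊆ level X n) ↔ Y ∈ superstructure X ∧ Y ∉ X := by
  constructor
  · rintro ⟨n, hn⟩
    refine ⟨⟨n + 1, mem_level_succ_of_subset hn⟩, fun hY => ?_⟩
    rcases ZFSet.eq_empty_or_nonempty Y with rfl | ⟨y, hy⟩
    · exact hX.1 hY
    · exact hX.2 Y hY y hy ⟨n, hn hy⟩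
  · rintro ⟨⟨n, hn⟩, hY⟩
    induction n with
    | zero => exact absurd hn hY
    | succ n ih =>
      rcases ZFSet.mem_union.1 hn with h | h
      · exact ih h
      · exact ⟨n, ZFSet.mem_powerset.1 h⟩

/-- A set in `V(X)`, as an element of `V(X)`. -/
def VSet.toVX {X : ZFSet.{u}} (Y : VSet X) : VX X :=
  ⟨Y.1, Y.2.elim fun n hn => ⟨n + 1, mem_level_succ_of_subset hn⟩⟩

/-- The type of elements of a set in `V(X)`. -/
abbrev VSet.Elem {X : ZFSet.{u}} (Y : VSet X) : Type (u + 1) := {y : ZFSet.{u} // y ∈ Y.1}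

/-- The subset `A` of a set `Y` in `V(X)`, seen as a set in `V(X)`. -/
noncomputable def VSet.ofSubset {X : ZFSet.{u}} {Y : VSet X} (A : Set Y.Elem) : VSet X :=
  ⟨ZFSet.sep (fun y => ∃ h : y ∈ Y.1, (⟨y, h⟩ : Y.Elem) ∈ A) Y.1,
    Y.2.elim fun n hn => ⟨n, fun _ hy => hn (ZFSet.mem_sep.1 hy).1⟩⟩

/-- The Cartesian product of two sets in `V(X)`. -/
noncomputable def VSet.prod {X : ZFSet.{u}} (Y Z : VSet X) : VSet X :=
  ⟨ZFSet.prod Y.1 Z.1, by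
    obtain ⟨m, hY⟩ := Y.2
    obtain ⟨n, hZ⟩ := Z.2
    refine ⟨max m n + 2, fun p hp => ?_⟩
    obtain ⟨a, ha, b, hb, rfl⟩ := ZFSet.mem_prod.1 hp
    exact pair_mem_level (level_mono (le_max_left m n) (hY ha))
      (level_mono (le_max_right m n) (hZ hb))⟩

/-! ### Bounded formulas and the transfer principle -/

/-- Formulas of the language of set theory all of whose quantifiers are bounded; the variables are
`x_0, x_1, x_2, …`. The other connectives and the bounded existential quantifier are definable. -/
inductive BddFormula : Type
  /-- `x_i ∈ x_j` -/
  | mem (i j : ℕ) : BddFormula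
  /-- `x_i = x_j` -/
  | eq (i j : ℕ) : BddFormula
  | not (φ : BddFormula) : BddFormula
  | and (φ ψ : BddFormula) : BddFormula
  /-- `∀ x_i ∈ x_j, φ` -/
  | ballMem (i j : ℕ) (φ : BddFormula) : BddFormula

/-- `V(X) ⊨ φ[v]`, where `v i` is the value of the variable `x_i`. -/
def BddFormula.Realize {X : ZFSet.{u}} : BddFormula → (ℕ → VX X) → Prop
  | .mem i j, v => (v i).1 ∈ (v j).1
  | .eq i j, v => v i = v j
  | .not φ, v => ¬ φ.Realize v
  | .and φ ψ, v => φ.Realize v ∧ ψ.Realize v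
  | .ballMem i j φ, v => ∀ y : VX X, y.1 ∈ (v j).1 → φ.Realize (Function.update v i y)

/-- A single superstructure model of nonstandard methods `⟨V(X), V(X), ∗⟩`: `X` is an infinite
(base) set and `∗ : V(X) → V(X)` satisfies the transfer principle. -/
structure SingleModel (X : ZFSet.{u}) where
  isBaseSet : IsBaseSet X
  infinite : {x : ZFSet.{u} | x ∈ X}.Infinite
  star : VX X → VX X
  transfer : ∀ (φ : BddFormula) (v : ℕ → VX X), φ.Realize v ↔ φ.Realize fun i => star (v i)

namespace SingleModel

variable {X : ZFSet.{u}} (M : SingleModel X)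

/-- The iterated star maps: `S_0 = id`, `S_{n+1} = ∗ ∘ S_n`. -/
def S : ℕ → VX X → VX X
  | 0 => id
  | n + 1 => M.star ∘ S n

/-- The elements of `V(X)` that belong to the `ω`-hyperextension `⋃ n, S_n(A)` of a set `A`. -/
def bullet (A : VSet X) : Set (VX X) := {α | ∃ n, α.1 ∈ (M.S n A.toVX).1}

/-- The set `Y` is coherent: `Y ⊆ ∗Y`. -/
def Coherent (Y : VSet X) : Prop := Y.1 ⊆ (M.star Y.toVX).1

/-- The set `Y` is completely coherent: every subset of `Y` is coherent. -/
def CompletelyCoherent (Y : VSet X) : Prop := ∀ A : VSet X, A.1 ⊆ Y.1 → M.Coherent A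

/-- The monad `μ_n(𝒰) = ⋂_{A ∈ 𝒰} S_n(A)` of an ultrafilter on `Y`. -/
def monad (n : ℕ) {Y : VSet X} (𝒰 : Ultrafilter Y.Elem) : Set (VX X) :=
  {α | ∀ A ∈ 𝒰, α.1 ∈ (M.S n (VSet.ofSubset A).toVX).1}

/-- The set `μ_∞(𝒰) = ⋂_{A ∈ 𝒰} ⋃_n S_n(A)` of generators of an ultrafilter on `Y`. -/
def generators {Y : VSet X} (𝒰 : Ultrafilter Y.Elem) : Set (VX X) :=
  {α | ∀ A ∈ 𝒰, α ∈ M.bullet (VSet.ofSubset A)}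

end SingleModel

/-! ### Tensor products of ultrafilters -/

/-- The ordered pair of an element of `Y` and one of `Z`, as an element of `Y × Z`. -/
noncomputable def VSet.mkPair {X : ZFSet.{u}} {Y Z : VSet X} (y : Y.Elem) (z : Z.Elem) :
    (Y.prod Z).Elem :=
  ⟨ZFSet.pair y.1 z.1, ZFSet.pair_mem_prod.2 ⟨y.2, z.2⟩⟩

/-- The tensor product `𝒰 ⊗ 𝒱`, an ultrafilter on `Y × Z`; see `mem_tensor`. -/
noncomputable def tensor {X : ZFSet.{u}} {Y Z : VSet X} (𝒰 : Ultrafilter Y.Elem)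
    (𝒱 : Ultrafilter Z.Elem) : Ultrafilter (Y.prod Z).Elem :=
  𝒰.bind fun y => 𝒱.map fun z => VSet.mkPair y z

theorem mem_tensor {X : ZFSet.{u}} {Y Z : VSet X} (𝒰 : Ultrafilter Y.Elem)
    (𝒱 : Ultrafilter Z.Elem) (A : Set (Y.prod Z).Elem) :
    A ∈ tensor 𝒰 𝒱 ↔ {y | {z | VSet.mkPair y z ∈ A} ∈ 𝒱} ∈ 𝒰 :=
  Iff.rfl

end IteratedHyper

open IteratedHyper

namespace IteratedHyper

theorem mem_superstructure_of_mem {X : ZFSet.{u}} (hX : IsBaseSet X) {x z : VX X}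
    (hz : z.1 ∈ x.1) {w : ZFSet.{u}} (hw : w ∈ x.1) : w ∈ superstructure X := by
  obtain ⟨n, hn⟩ := (isSet_iff hX x.1).2 ⟨x.2, fun hx => hX.2 _ hx _ hz z.2⟩
  exact ⟨n, hn hw⟩

/-- Extensionality for elements of `V(X)` that have members in `V(X)`. -/
theorem VX.ext_of_mem {X : ZFSet.{u}} (hX : IsBaseSet X) {x y z : VX X} (hz : z.1 ∈ x.1)
    (h : ∀ w : VX X, w.1 ∈ x.1 ↔ w.1 ∈ y.1) : x = y := by
  refine Subtype.ext (ZFSet.ext fun w => ⟨fun hw => ?_, fun hw => ?_⟩)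
  · exact (h ⟨w, mem_superstructure_of_mem hX hz hw⟩).1 hw
  · exact (h ⟨w, mem_superstructure_of_mem hX ((h z).1 hz) hw⟩).2 hw

/-- The unordered pair of two elements of `V(X)`. -/
noncomputable def VX.upair {X : ZFSet.{u}} (x y : VX X) : VX X :=
  ⟨{x.1, y.1}, by
    obtain ⟨m, hx⟩ := x.2
    obtain ⟨n, hy⟩ := y.2
    refine ⟨max m n + 1, mem_level_succ_of_subset fun w hw => ?_⟩
    rcases ZFSet.mem_pair.1 hw with rfl | rfl
    · exact level_mono (le_max_left m n) hx
    · exact level_mono (le_max_right m n) hy⟩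

theorem VX.mem_upair {X : ZFSet.{u}} {x y w : VX X} :
    w.1 ∈ (VX.upair x y).1 ↔ w = x ∨ w = y := by
  simp [VX.upair, Subtype.ext_iff]

theorem VX.eq_upair_iff {X : ZFSet.{u}} (hX : IsBaseSet X) {s x y : VX X} :
    s = VX.upair x y ↔
      x.1 ∈ s.1 ∧ y.1 ∈ s.1 ∧ ∀ t : VX X, t.1 ∈ s.1 → t = x ∨ t = y := by
  constructor
  · rintro rfl
    exact ⟨VX.mem_upair.2 (.inl rfl), VX.mem_upair.2 (.inr rfl), fun t => VX.mem_upair.1⟩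
  · rintro ⟨hx, hy, h⟩
    refine VX.ext_of_mem hX hx fun w => ⟨fun hw => VX.mem_upair.2 (h w hw), fun hw => ?_⟩
    rcases VX.mem_upair.1 hw with rfl | rfl <;> assumption

theorem VX.pair_eq_upair {X : ZFSet.{u}} (x y : VX X) :
    VX.pair x y = VX.upair (VX.upair x x) (VX.upair x y) := by
  refine Subtype.ext ?_
  simp [VX.pair, VX.upair, ZFSet.pair]

namespace BddFormula

/-- `x_s = {x_a, x_b}`, with bound variable `x_20`. -/
def isUpair (s a b : ℕ) : BddFormula :=
  .and (.mem a s) (.and (.mem b s) (.ballMem 20 s (.not (.and (.not (.eq 20 a)) (.not (.eq 20 b))))))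

/-- `∃ x_i ∈ x_j, φ` -/
def bexMem (i j : ℕ) (φ : BddFormula) : BddFormula := .not (.ballMem i j (.not φ))

/-- `x_p = (x_a, x_b)`, with bound variables `x_10`, `x_11` and `x_20`. -/
def isPair (p a b : ℕ) : BddFormula :=
  .bexMem 10 p (.bexMem 11 p (.and (.isUpair p 10 11) (.and (.isUpair 10 a a) (.isUpair 11 a b))))

variable {X : ZFSet.{u}}

theorem realize_bexMem {i j : ℕ} {φ : BddFormula} {v : ℕ → VX X} :
    (bexMem i j φ).Realize v ↔ ∃ y : VX X, y.1 ∈ (v j).1 ∧ φ.Realize (Function.update v i y) := by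
  simp only [bexMem, Realize]
  push Not
  rfl

theorem realize_isUpair (hX : IsBaseSet X) {s a b : ℕ} (ha : a < 20) (hb : b < 20)
    {v : ℕ → VX X} : (isUpair s a b).Realize v ↔ v s = VX.upair (v a) (v b) := by
  simp only [isUpair, Realize, VX.eq_upair_iff hX, Function.update_self,
    Function.update_of_ne ha.ne, Function.update_of_ne hb.ne, ← not_or, not_not]

theorem realize_isPair (hX : IsBaseSet X) {p a b : ℕ} (hp : p < 10) (ha : a < 10) (hb : b < 10)
    {v : ℕ → VX X} : (isPair p a b).Realize v ↔ v p = VX.pair (v a) (v b) := by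
  have h : ∀ {k}, k < 10 → ∀ s d : VX X,
      Function.update (Function.update v 10 s) 11 d k = v k := fun hk s d => by
    rw [Function.update_of_ne (by lia), Function.update_of_ne (by lia)]
  have h10 : ∀ s d : VX X, Function.update (Function.update v 10 s) 11 d 10 = s := fun s d => by
    rw [Function.update_of_ne (by lia), Function.update_self]
  simp only [isPair, realize_bexMem, Realize,
    realize_isUpair hX (s := p) (show 10 < 20 by lia) (show 11 < 20 by lia),
    realize_isUpair hX (s := 10) (show a < 20 by lia) (show a < 20 by lia),
    realize_isUpair hX (s := 11) (show a < 20 by lia) (show b < 20 by lia),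
    h hp, h ha, h hb, h10, Function.update_self, Function.update_of_ne (show p ≠ 10 by lia),
    VX.pair_eq_upair]
  constructor
  · rintro ⟨s, -, d, -, h₁, rfl, rfl⟩
    exact h₁
  · intro h₁
    refine ⟨_, ?_, _, ?_, h₁, rfl, rfl⟩ <;> rw [h₁, VX.mem_upair]
    exacts [.inl rfl, .inr rfl]

end BddFormula

theorem VSet.mem_ofSubset {X : ZFSet.{u}} {Y : VSet X} {A : Set Y.Elem} {w : ZFSet.{u}} :
    w ∈ (VSet.ofSubset A).toVX.1 ↔ ∃ h : w ∈ Y.1, (⟨w, h⟩ : Y.Elem) ∈ A := by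
  simp only [VSet.toVX, VSet.ofSubset, ZFSet.mem_sep]
  exact ⟨fun h => h.2, fun h => ⟨h.1, h⟩⟩

namespace SingleModel

variable {X : ZFSet.{u}} (M : SingleModel X)

theorem S_add (n m : ℕ) (x : VX X) : M.S (n + m) x = M.S n (M.S m x) := by
  induction n with
  | zero => rw [Nat.zero_add]; rfl
  | succ n ih => rw [Nat.succ_add]; exact congrArg M.star ih

/-- The transfer principle for the iterated star maps. -/
theorem transfer_S (n : ℕ) (φ : BddFormula) (v : ℕ → VX X) :
    φ.Realize v ↔ φ.Realize fun i => M.S n (v i) := by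
  induction n with
  | zero => rfl
  | succ n ih => exact ih.trans (M.transfer φ _)

theorem pair_mem_S_of_left (n : ℕ) {B A c : VX X}
    (h : ∀ w : VX X, w.1 ∈ B.1 → (VX.pair w c).1 ∈ A.1) {w : VX X} (hw : w.1 ∈ (M.S n B).1) :
    (VX.pair w (M.S n c)).1 ∈ (M.S n A).1 := by
  have key := M.transfer_S n (.ballMem 3 0 (.bexMem 4 1 (.isPair 4 3 2)))
    (fun i => if i = 0 then B else if i = 1 then A else c)
  simp only [BddFormula.Realize, BddFormula.realize_bexMem,
    BddFormula.realize_isPair M.isBaseSet (show 4 < 10 by lia) (show 3 < 10 by lia)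
      (show 2 < 10 by lia)] at key
  simp at key
  exact key.1 (fun w hw => h ⟨w, hw⟩) w.1 w.2 hw

theorem pair_mem_S_of_right (n : ℕ) {B A c : VX X}
    (h : ∀ w : VX X, w.1 ∈ B.1 → (VX.pair c w).1 ∈ A.1) {w : VX X} (hw : w.1 ∈ (M.S n B).1) :
    (VX.pair (M.S n c) w).1 ∈ (M.S n A).1 := by
  have key := M.transfer_S n (.ballMem 3 0 (.bexMem 4 1 (.isPair 4 2 3)))
    (fun i => if i = 0 then B else if i = 1 then A else c)
  simp only [BddFormula.Realize, BddFormula.realize_bexMem,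
    BddFormula.realize_isPair M.isBaseSet (show 4 < 10 by lia) (show 2 < 10 by lia)
      (show 3 < 10 by lia)] at key
  simp at key
  exact key.1 (fun w hw => h ⟨w, hw⟩) w.1 w.2 hw

variable {M}

/-- The star map fixes the elements of a completely coherent set. -/
theorem CompletelyCoherent.star_eq {Y : VSet X} (hY : M.CompletelyCoherent Y) {y : VX X}
    (hy : y.1 ∈ Y.1) : M.star y = y := by
  obtain ⟨n, hn⟩ := Y.2
  let A : VSet X := ⟨{y.1}, n, fun w hw => by
    rw [ZFSet.mem_singleton.1 hw]
    exact hn hy⟩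
  have hA : y.1 ∈ (M.star A.toVX).1 :=
    hY A (fun w hw => by rw [ZFSet.mem_singleton.1 hw]; exact hy) (ZFSet.mem_singleton.2 rfl)
  have key := (M.transfer (.ballMem 2 0 (.eq 2 1)) (fun i => if i = 0 then A.toVX else y)).1
    fun w hw => Subtype.ext (ZFSet.mem_singleton.1 hw)
  exact (key y hA).symm

theorem CompletelyCoherent.S_eq {Y : VSet X} (hY : M.CompletelyCoherent Y) {y : VX X}
    (hy : y.1 ∈ Y.1) (n : ℕ) : M.S n y = y := by
  induction n with
  | zero => rfl
  | succ n ih => exact (congrArg M.star ih).trans (hY.star_eq hy)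

theorem CompletelyCoherent.pair_mem_monad_tensor {Y Z : VSet X} (hY : M.CompletelyCoherent Y)
    {n m : ℕ} {𝒰 : Ultrafilter Y.Elem} {𝒱 : Ultrafilter Z.Elem} {α β : VX X}
    (hα : α ∈ M.monad n 𝒰) (hβ : β ∈ M.monad m 𝒱) :
    VX.pair α (M.S n β) ∈ M.monad (n + m) (tensor 𝒰 𝒱) := by
  intro A hA
  rw [S_add]
  refine M.pair_mem_S_of_left n (fun y hy => ?_) (hα _ ((mem_tensor 𝒰 𝒱 A).1 hA))
  obtain ⟨hyY, hyA⟩ := VSet.mem_ofSubset.1 hy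
  rw [← hY.S_eq hyY m]
  refine M.pair_mem_S_of_right m (fun z hz => ?_) (hβ _ hyA)
  obtain ⟨hzZ, hzA⟩ := VSet.mem_ofSubset.1 hz
  exact VSet.mem_ofSubset.2 ⟨ZFSet.pair_mem_prod.2 ⟨hyY, hzZ⟩, hzA⟩

theorem monad_subset_generators {Y : VSet X} (n : ℕ) (𝒰 : Ultrafilter Y.Elem) :
    M.monad n 𝒰 ⊆ M.generators 𝒰 := fun _ h A hA => ⟨n, h A hA⟩

end SingleModel

end IteratedHyper

theorem mainTheorem3 {X : ZFSet.{u}} (M : SingleModel X) (n m : ℕ) (S₁ S₂ : VSet X)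
    (hS₁ : M.CompletelyCoherent S₁) (𝒰 : Ultrafilter S₁.Elem) (𝒱 : Ultrafilter S₂.Elem)
    (α β : VX X) (hα : α ∈ M.monad n 𝒰) (hβ : β ∈ M.monad m 𝒱) :
    VX.pair α (M.S n β) ∈ M.monad (n + m) (tensor 𝒰 𝒱) ∧
      VX.pair α (M.S n β) ∈ M.generators (tensor 𝒰 𝒱) := by
  have h := hS₁.pair_mem_monad_tensor hα hβ
  exact ⟨h, SingleModel.monad_subset_generators _ _ h⟩
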